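/- Let $X$ and $Y$ be real Banach spaces, let $F : X \rightrightarrows Y$ be a set-valued mapping whose graph $\{(x,y)\in X\times Y : y\in F(x)\}$ is convex and closed, and let $f : X \to Y$ be a function that is strictly (Fréchet) differentiable at $\bar x \in X$, with strict derivative $\nabla f(\bar x)$. Let $\bar y \in Y$ satisfy $\bar y \in f(\bar x) + F(\bar x)$, and suppose that $$\bar y \in \operatorname{int}\, \bigcup_{x\in X}\bigl(f(\bar x) + \nabla f(\bar x)(x-\bar x) + F(x)\bigr).$$ Then there exist neighborhoods $U$ of $\bar x$ and $V$ of $\bar y$, a continuous function $x(\cdot) : V \to U$, and a constant $\gamma > 0$ such that $$y \in f(x(y)) + F(x(y)) \quad\text{and}\quad \|x(y) - \bar x\| \le \gamma \|y - \bar y\| \quad\text{for every } y \in V.$$ -/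

import Mathlib

open Topology

/-- The graph `{(x, y) | y ∈ F x}` of a set-valued mapping `F : X ⇉ Y`. -/
def setValuedGraph {X Y : Type*} (F : X → Set Y) : Set (X × Y) :=
  {p | p.2 ∈ F p.1}

/-- The image (range) `{y | ∃ x, y ∈ F x}` of a set-valued mapping `F : X ⇉ Y`. -/
def setValuedImage {X Y : Type*} (F : X → Set Y) : Set Y :=
  {y | ∃ x, y ∈ F x}

/-- The sum `g + F : X ⇉ Y`, `(g + F)(x) = {g x + z | z ∈ F x}`, of a function and a
set-valued mapping. -/
def funAddSetValued {X Y : Type*} [Add Y] (g : X → Y) (F : X → Set Y) : X → Set Y :=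
  fun x => {y | ∃ z ∈ F x, y = g x + z}

open Set Filter Metric

/-! After translation, the linearized inclusion is governed by a closed convex set `C` whose
projection to `Y` covers a neighborhood of `0`; the nonlinear part becomes a perturbation `g` with
zero strict derivative. Baire's theorem gives almost-preimages of bounded norm, and a partition of
unity glues them continuously, since all constraints are convex. Moving a point of `C` towards such
an almost-preimage gives a continuous correction step (`exists_continuous_correction`). Iterating it
halves the residual, so the iterates converge uniformly, and their limit is a continuous exact
solution. -/

/-- If `0` is interior to the projection of a convex set `C`, then the projections of the bounded
parts of `C` are eventually dense in a neighborhood of `0`. -/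
theorem exists_ball_subset_closure_snd_image {X Y : Type*}
    [NormedAddCommGroup X] [NormedSpace ℝ X]
    [NormedAddCommGroup Y] [NormedSpace ℝ Y] [CompleteSpace Y]
    {C : Set (X × Y)} (hconv : Convex ℝ C) (hint : (0 : Y) ∈ interior (Prod.snd '' C)) :
    ∃ M > 0, ∃ r > 0, closedBall (0 : Y) r ⊆ closure (Prod.snd '' (C ∩ closedBall 0 M)) := by
  set A : ℕ → Set Y := fun n => Prod.snd '' (C ∩ closedBall 0 (n : ℝ)) with hA
  have hAmono : Monotone A := fun m n hmn =>
    image_mono (inter_subset_inter_right _ (closedBall_subset_closedBall (by exact_mod_cast hmn)))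
  have hcover : Prod.snd '' C ⊆ ⋃ n, A n := by
    rintro _ ⟨p, hp, rfl⟩
    obtain ⟨n, hn⟩ := exists_nat_ge ‖p‖
    exact mem_iUnion.2 ⟨n, p, ⟨hp, by simpa using hn⟩, rfl⟩
  -- Baire: a nonempty open set is not a countable union of nowhere dense sets.
  obtain ⟨n, z, hz⟩ : ∃ n, (interior (closure (A n))).Nonempty := by
    by_contra! h
    refine not_isMeagre_of_isOpen isOpen_interior ⟨0, hint⟩ ?_
    exact (isMeagre_iUnion fun n => IsNowhereDense.isMeagre (h n)).mono
      (interior_subset.trans hcover)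
  -- `0` lies strictly between the interior point `z` and `-(t • z)`, so convexity makes it
  -- interior.
  obtain ⟨t, ht, ht0⟩ : ∃ t : ℝ, -(t • z) ∈ Prod.snd '' C ∧ 0 < t := by
    have hc : Tendsto (fun t : ℝ => -(t • z)) (𝓝[>] 0) (𝓝 0) := by
      have : Continuous fun t : ℝ => -(t • z) := by fun_prop
      simpa using (this.tendsto 0).mono_left nhdsWithin_le_nhds
    exact ((hc.eventually (mem_interior_iff_mem_nhds.1 hint)).and self_mem_nhdsWithin).exists
  obtain ⟨m, hm⟩ := mem_iUnion.1 (hcover ht)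
  set N := max n m + 1 with hN
  have hAc : Convex ℝ (closure (A N)) :=
    ((hconv.inter (convex_closedBall _ _)).linear_image (LinearMap.snd ℝ X Y)).closure
  have h0 : (0 : Y) ∈ interior (closure (A N)) := by
    have h1 : z ∈ interior (closure (A N)) :=
      interior_mono (closure_mono (hAmono (by omega))) hz
    have h2 : -(t • z) ∈ closure (A N) := subset_closure (hAmono (by omega) hm)
    have := hAc.combo_interior_self_mem_interior h1 h2 (a := t / (1 + t)) (b := 1 / (1 + t))
      (by positivity) (by positivity) (by field_simp; ring)
    convert this using 1
    rw [smul_neg, smul_smul, one_div_mul_eq_div, add_neg_cancel]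
  obtain ⟨r, hr, hball⟩ := nhds_basis_closedBall.mem_iff.1 (mem_interior_iff_mem_nhds.1 h0)
  exact ⟨N, by positivity, r, hr, hball⟩

/-- A continuous bounded approximate selection of the inverse of a projection. -/
theorem exists_continuous_approx_selection {X Y : Type*}
    [NormedAddCommGroup X] [NormedSpace ℝ X] [NormedAddCommGroup Y] [NormedSpace ℝ Y]
    {C : Set (X × Y)} (hconv : Convex ℝ C) (h0 : (0 : X × Y) ∈ C) {M r δ : ℝ}
    (hM : 0 < M) (hδ : 0 < δ)
    (hball : closedBall (0 : Y) r ⊆ closure (Prod.snd '' (C ∩ closedBall 0 M))) :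
    ∃ s : C(Y, X × Y), ∀ y, s y ∈ C ∧ ‖s y‖ ≤ M ∧ (‖y‖ ≤ r → ‖(s y).2 - y‖ ≤ δ) := by
  refine exists_continuous_forall_mem_convex_of_local_const
    (t := fun y => {p | p ∈ C ∧ ‖p‖ ≤ M ∧ (‖y‖ ≤ r → ‖p.2 - y‖ ≤ δ)}) (fun y => ?_) fun y => ?_
  · by_cases hy : ‖y‖ ≤ r
    · convert! (hconv.inter (convex_closedBall 0 M)).inter
        ((convex_closedBall y δ).linear_preimage (LinearMap.snd ℝ X Y)) using 1
      ext p
      simp only [hy, true_imp_iff, mem_inter_iff, mem_preimage,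
        LinearMap.snd_apply, mem_closedBall, dist_eq_norm, sub_zero, and_assoc]
      rfl
    · convert! hconv.inter (convex_closedBall 0 M) using 1
      ext p
      simp [hy]
  · rcases le_or_gt ‖y‖ r with hy | hy
    · obtain ⟨_, ⟨p, ⟨hpC, hpM⟩, rfl⟩, hpy⟩ :=
        Metric.mem_closure_iff.1 (hball (mem_closedBall_zero_iff.2 hy)) δ hδ
      refine ⟨p, ?_⟩
      filter_upwards [isOpen_ball.mem_nhds (mem_ball.2 hpy)] with y' hy'
      refine ⟨hpC, mem_closedBall_zero_iff.1 hpM, fun _ => ?_⟩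
      rw [← dist_eq_norm, dist_comm]
      exact (mem_ball.1 hy').le
    · refine ⟨0, ?_⟩
      filter_upwards [(continuous_norm.tendsto y).eventually_const_lt hy] with y' hy'
      exact ⟨h0, by simpa using hM.le, fun h => absurd h hy'.not_ge⟩

/-- A continuous correction step: a point `p` of `C` is moved inside `C`, at a cost linear in
`‖e‖`, so that its second coordinate changes by `e` up to a relative error `1 / 4`. -/
theorem exists_continuous_correction {X Y : Type*}
    [NormedAddCommGroup X] [NormedSpace ℝ X]
    [NormedAddCommGroup Y] [NormedSpace ℝ Y] [CompleteSpace Y]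
    {C : Set (X × Y)} (hconv : Convex ℝ C) (h0 : (0 : X × Y) ∈ C)
    (hint : (0 : Y) ∈ interior (Prod.snd '' C)) :
    ∃ Φ : (X × Y) × Y → X × Y, Continuous Φ ∧ ∃ K > 0, ∃ r > 0, ∀ p ∈ C, ‖p‖ ≤ r →
      ∀ e : Y, ‖e‖ ≤ r → Φ (p, e) ∈ C ∧ ‖Φ (p, e) - p‖ ≤ K * ‖e‖ ∧
        ‖(Φ (p, e)).2 - (p.2 + e)‖ ≤ ‖e‖ / 4 := by
  obtain ⟨M, hM, R, hR, hball⟩ := exists_ball_subset_closure_snd_image hconv hint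
  obtain ⟨r, hr, hrR⟩ : ∃ r > 0, R = r + r := ⟨R / 2, by positivity, by ring⟩
  obtain ⟨s, hs⟩ := exists_continuous_approx_selection hconv h0 hM
    (show 0 < r / 4 by positivity) hball
  -- With `t = ‖e‖ / r`, the target height `y = p.2 + t⁻¹ • e` satisfies `(1 - t) • p.2 + t • y =
  -- p.2 + e`. The selection error `r / 4` is scaled by `t` to `‖e‖ / 4`.
  set σ : (X × Y) × Y → X × Y := fun q => s (q.1.2 + (r / ‖q.2‖) • q.2) - q.1 with hσ
  refine ⟨fun q => q.1 + (‖q.2‖ / r) • σ q, ?_, (M + r) / r, by positivity, r, hr, ?_⟩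
  · refine continuous_fst.add (continuous_iff_continuousAt.2 fun q => ?_)
    -- The direction of `e` jumps at `0`, but `σ` stays locally bounded and its factor vanishes.
    by_cases hq : q.2 = 0
    · have hlim : Tendsto (fun q' : (X × Y) × Y => (‖q'.2‖ / r) * (M + ‖q'.1‖)) (𝓝 q) (𝓝 0) := by
        have : Continuous fun q' : (X × Y) × Y => (‖q'.2‖ / r) * (M + ‖q'.1‖) := by fun_prop
        simpa [hq] using this.tendsto q
      rw [ContinuousAt, hq, norm_zero, zero_div, zero_smul]
      refine squeeze_zero_norm (fun q' => ?_) hlim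
      rw [norm_smul, Real.norm_of_nonneg (by positivity)]
      gcongr
      exact (norm_sub_le _ _).trans (by gcongr; exact (hs _).2.1)
    · have hq' : ‖q.2‖ ≠ 0 := norm_ne_zero_iff.2 hq
      have : ContinuousAt (fun q : (X × Y) × Y => q.1.2 + (r / ‖q.2‖) • q.2) q := by
        fun_prop (disch := assumption)
      have h2 := (s.continuous.continuousAt.comp this).sub continuous_fst.continuousAt
      exact (continuous_snd.norm.div_const r).continuousAt.smul h2
  · intro p hp hpr e he
    set y := p.2 + (r / ‖e‖) • e with hy
    obtain ⟨hsC, hsM, hsy⟩ := hs y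
    have ht1 : ‖e‖ / r ≤ 1 := (div_le_one hr).2 he
    have hyr : ‖y‖ ≤ R := by
      rw [hrR]
      refine (norm_add_le _ _).trans (add_le_add ((norm_snd_le p).trans hpr) ?_)
      rw [norm_smul, Real.norm_of_nonneg (by positivity)]
      rcases eq_or_ne ‖e‖ 0 with h | h
      · simpa [h] using hr.le
      · exact (div_mul_cancel₀ r h).le
    have hse : (‖e‖ / r) • ((r / ‖e‖) • e) = e := by
      rcases eq_or_ne e 0 with rfl | hne
      · simp
      · rw [smul_smul, div_mul_div_cancel₀ hr.ne', div_self (norm_ne_zero_iff.2 hne), one_smul]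
    refine ⟨hconv.add_smul_sub_mem hp hsC ⟨by positivity, ht1⟩, ?_, ?_⟩
    · rw [add_sub_cancel_left, norm_smul, Real.norm_of_nonneg (by positivity)]
      calc ‖e‖ / r * ‖s y - p‖ ≤ ‖e‖ / r * (M + r) := by
            gcongr
            exact (norm_sub_le _ _).trans (add_le_add hsM hpr)
        _ = (M + r) / r * ‖e‖ := by ring
    · have heq : (p + (‖e‖ / r) • (s y - p)).2 - (p.2 + e)
          = (‖e‖ / r) • ((s y).2 - y) := by
        have : (‖e‖ / r) • y = (‖e‖ / r) • p.2 + e := by rw [hy, smul_add, hse]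
        rw [smul_sub _ _ y, this, Prod.snd_add, Prod.smul_snd, Prod.snd_sub, smul_sub]
        abel
      change ‖(p + (‖e‖ / r) • (s y - p)).2 - (p.2 + e)‖ ≤ _
      rw [heq, norm_smul, Real.norm_of_nonneg (by positivity)]
      calc ‖e‖ / r * ‖(s y).2 - y‖ ≤ ‖e‖ / r * (r / 4) := by gcongr; exact hsy hyr
        _ = ‖e‖ / 4 := by field_simp

/-- Continuous solutions of `(u, w - g u) ∈ C` for a closed convex set `C` and a perturbation `g`
with vanishing strict derivative. -/
theorem exists_continuousOn_selection_of_strict_zero {X Y : Type*}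
    [NormedAddCommGroup X] [NormedSpace ℝ X] [CompleteSpace X]
    [NormedAddCommGroup Y] [NormedSpace ℝ Y] [CompleteSpace Y]
    {C : Set (X × Y)} (hconv : Convex ℝ C) (hclosed : IsClosed C) (h0 : (0 : X × Y) ∈ C)
    (hint : (0 : Y) ∈ interior (Prod.snd '' C))
    {g : X → Y} (hg0 : g 0 = 0) (hg : HasStrictFDerivAt g (0 : X →L[ℝ] Y) 0) :
    ∃ η > 0, ∃ γ > 0, ∃ u : Y → X, ContinuousOn u (ball 0 η) ∧
      ∀ w ∈ ball (0 : Y) η, (u w, w - g (u w)) ∈ C ∧ ‖u w‖ ≤ γ * ‖w‖ := by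
  obtain ⟨Φ, hΦ, K, hK, r, hr, hstep⟩ := exists_continuous_correction hconv h0 hint
  -- A step of length `K * ‖e‖` changes `g` by at most `‖e‖ / 4`; with the error `‖e‖ / 4` of `Φ`,
  -- the residual halves.
  obtain ⟨S, hS, hlip⟩ := hg.exists_lipschitzOnWith_of_nnnorm_lt
    (Real.toNNReal (1 / (4 * K))) (by simpa using by positivity)
  obtain ⟨ρ, hρ, hρS⟩ := nhds_basis_closedBall.mem_iff.1 hS
  have hglip : ∀ x x' : X, ‖x‖ ≤ ρ → ‖x'‖ ≤ ρ → ‖g x - g x'‖ ≤ 1 / (4 * K) * ‖x - x'‖ := by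
    intro x x' hx hx'
    have := hlip.dist_le_mul x (hρS (by simpa using hx)) x' (hρS (by simpa using hx'))
    rwa [Real.coe_toNNReal _ (by positivity), dist_eq_norm, dist_eq_norm] at this
  set p : ℕ → Y → X × Y := fun n => Nat.rec (fun _ => 0)
    (fun _ q w => Φ (q w, w - g (q w).1 - (q w).2)) n with hp
  have hp0 : ∀ w, p 0 w = 0 := fun _ => rfl
  have hps : ∀ n w, p (n + 1) w = Φ (p n w, w - g (p n w).1 - (p n w).2) := fun _ _ => rfl
  clear_value p
  set m := min ρ r with hm
  have hm0 : 0 < m := lt_min hρ hr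
  -- The step lengths sum to at most `2 * K * ‖w‖`, which must not exceed `m`.
  set η := min r (m / (2 * K)) with hη
  have hη0 : 0 < η := by positivity
  have hbound : ∀ w ∈ ball (0 : Y) η, ‖w‖ ≤ r ∧ 2 * K * ‖w‖ ≤ m := by
    intro w hw
    have h := (mem_ball_zero_iff.1 hw).le
    refine ⟨h.trans (min_le_left _ _), ?_⟩
    have := h.trans (min_le_right _ _)
    rwa [le_div_iff₀ (by positivity), mul_comm] at this
  have hinv : ∀ w ∈ ball (0 : Y) η, ∀ n, p n w ∈ C ∧
      ‖p n w‖ ≤ 2 * K * ‖w‖ * (1 - (1 / 2) ^ n) ∧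
      ‖w - g (p n w).1 - (p n w).2‖ ≤ ‖w‖ * (1 / 2) ^ n := by
    intro w hw n
    obtain ⟨hwr, hwm⟩ := hbound w hw
    have hsmall : ∀ n : ℕ, 2 * K * ‖w‖ * (1 - (1 / 2) ^ n) ≤ m := fun n => by
      have : (0 : ℝ) < (1 / 2) ^ n := by positivity
      refine (mul_le_of_le_one_right (by positivity) (by linarith)).trans hwm
    induction n with
    | zero => simp [hp0, h0, hg0]
    | succ n ih =>
      obtain ⟨ihC, ihn, ihe⟩ := ih
      set e := w - g (p n w).1 - (p n w).2 with he
      have hpow : ((1 : ℝ) / 2) ^ n ≤ 1 := pow_le_one₀ (by norm_num) (by norm_num)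
      have hpm := ihn.trans (hsmall n)
      have her : ‖e‖ ≤ r := (ihe.trans (mul_le_of_le_one_right (norm_nonneg _) hpow)).trans hwr
      obtain ⟨h1, h2, h3⟩ := hstep (p n w) ihC (hpm.trans (min_le_right _ _)) e her
      rw [hps]
      set q := Φ (p n w, e) with hq
      have hqn : ‖q‖ ≤ 2 * K * ‖w‖ * (1 - (1 / 2) ^ (n + 1)) := by
        have h4 : ‖q‖ ≤ ‖q - p n w‖ + ‖p n w‖ := norm_le_norm_sub_add q _
        have h5 : K * ‖e‖ ≤ K * (‖w‖ * (1 / 2) ^ n) := by gcongr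
        rw [pow_succ]
        linarith
      refine ⟨h1, hqn, ?_⟩
      have hqρ : ‖q.1‖ ≤ ρ :=
        (norm_fst_le q).trans ((hqn.trans (hsmall _)).trans (min_le_left _ _))
      have hpρ : ‖(p n w).1‖ ≤ ρ := (norm_fst_le _).trans (hpm.trans (min_le_left _ _))
      have h6 : ‖(p n w).1 - q.1‖ ≤ K * ‖e‖ := by
        rw [norm_sub_rev]
        exact (norm_fst_le (q - p n w)).trans h2
      have h7 : ‖g (p n w).1 - g q.1‖ ≤ ‖e‖ / 4 :=
        calc _ ≤ 1 / (4 * K) * ‖(p n w).1 - q.1‖ := hglip _ _ hpρ hqρ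
          _ ≤ 1 / (4 * K) * (K * ‖e‖) := by gcongr
          _ = ‖e‖ / 4 := by field_simp
      have h8 : w - g q.1 - q.2 = (g (p n w).1 - g q.1) - (q.2 - ((p n w).2 + e)) := by
        rw [he]; abel
      rw [h8, pow_succ]
      have := norm_sub_le (g (p n w).1 - g q.1) (q.2 - ((p n w).2 + e))
      linarith
  have hfst : ∀ w ∈ ball (0 : Y) η, ∀ n, ‖p n w‖ ≤ m := fun w hw n => by
    have : (0 : ℝ) < (1 / 2) ^ n := by positivity
    have h1 := (hinv w hw n).2.1
    exact (h1.trans (mul_le_of_le_one_right (by positivity) (by linarith))).trans (hbound w hw).2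
  have hgcont : ContinuousOn g (closedBall 0 ρ) := hlip.continuousOn.mono hρS
  have hcont : ∀ n, ContinuousOn (p n) (ball 0 η) := by
    intro n
    induction n with
    | zero => exact continuousOn_const.congr fun w _ => hp0 w
    | succ n ih =>
      have h1 : ContinuousOn (fun w => g (p n w).1) (ball 0 η) :=
        hgcont.comp (continuous_fst.comp_continuousOn ih) fun w hw => mem_closedBall_zero_iff.2
          ((norm_fst_le _).trans ((hfst w hw n).trans (min_le_left _ _)))
      have h2 : ContinuousOn (fun w => (p n w, w - g (p n w).1 - (p n w).2)) (ball 0 η) :=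
        ih.prodMk ((continuousOn_id.sub h1).sub (continuous_snd.comp_continuousOn ih))
      exact (hΦ.comp_continuousOn h2).congr fun w _ => hps n w
  have hdist : ∀ w ∈ ball (0 : Y) η, ∀ n, dist (p n w) (p (n + 1) w) ≤ K * ‖w‖ * (1 / 2) ^ n := by
    intro w hw n
    obtain ⟨h1, -, h3⟩ := hinv w hw n
    have her : ‖w - g (p n w).1 - (p n w).2‖ ≤ r :=
      (h3.trans (mul_le_of_le_one_right (norm_nonneg _)
        (pow_le_one₀ (by norm_num) (by norm_num)))).trans (hbound w hw).1
    rw [dist_comm, dist_eq_norm, hps, mul_assoc]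
    exact (hstep _ h1 ((hfst w hw n).trans (min_le_right _ _)) _ her).2.1.trans (by gcongr)
  have hex : ∀ w, ∃ a, w ∈ ball (0 : Y) η → Tendsto (fun n => p n w) atTop (𝓝 a) := by
    intro w
    by_cases hw : w ∈ ball (0 : Y) η
    · obtain ⟨a, ha⟩ := cauchySeq_tendsto_of_complete
        (cauchySeq_of_le_geometric (1 / 2) _ (by norm_num) (hdist w hw))
      exact ⟨a, fun _ => ha⟩
    · exact ⟨0, fun h => absurd h hw⟩
  choose P hP using hex
  have hPdist : ∀ w ∈ ball (0 : Y) η, ∀ n, dist (p n w) (P w) ≤ 2 * K * ‖w‖ * (1 / 2) ^ n := by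
    intro w hw n
    have := dist_le_of_le_geometric_of_tendsto (1 / 2) _ (by norm_num) (hdist w hw) (hP w hw) n
    exact this.trans_eq (by ring)
  have hunif : TendstoUniformlyOn p P atTop (ball 0 η) := by
    rw [Metric.tendstoUniformlyOn_iff]
    intro ε hε
    have hlim : Tendsto (fun n : ℕ => m * (1 / 2 : ℝ) ^ n) atTop (𝓝 0) := by
      simpa using (tendsto_pow_atTop_nhds_zero_of_lt_one (r := (1 / 2 : ℝ))
        (by norm_num) (by norm_num)).const_mul m
    filter_upwards [hlim.eventually_lt_const hε] with n hn w hw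
    rw [dist_comm]
    refine ((hPdist w hw n).trans ?_).trans_lt hn
    gcongr
    exact (hbound w hw).2
  have hPcont : ContinuousOn P (ball 0 η) :=
    hunif.continuousOn (Frequently.of_forall hcont)
  refine ⟨η, hη0, 2 * K, by positivity, fun w => (P w).1,
    continuous_fst.comp_continuousOn hPcont, fun w hw => ?_⟩
  have hPn : ‖P w‖ ≤ 2 * K * ‖w‖ := by simpa [hp0] using hPdist w hw 0
  have hPC : P w ∈ C :=
    hclosed.mem_of_tendsto (hP w hw) (Eventually.of_forall fun n => (hinv w hw n).1)
  refine ⟨?_, (norm_fst_le _).trans hPn⟩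
  have hfstP : Tendsto (fun n => (p n w).1) atTop (𝓝 (P w).1) :=
    (continuous_fst.tendsto _).comp (hP w hw)
  have hgP : Tendsto (fun n => g (p n w).1) atTop (𝓝 (g (P w).1)) := by
    refine (hgcont (P w).1 (mem_closedBall_zero_iff.2 ((norm_fst_le _).trans
      (hPn.trans ((hbound w hw).2.trans (min_le_left _ _)))))).tendsto.comp
      (tendsto_nhdsWithin_iff.2 ⟨hfstP, Eventually.of_forall fun n => mem_closedBall_zero_iff.2
        ((norm_fst_le _).trans ((hfst w hw n).trans (min_le_left _ _)))⟩)
  have hres : Tendsto (fun n => w - g (p n w).1 - (p n w).2) atTop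
      (𝓝 (w - g (P w).1 - (P w).2)) :=
    (tendsto_const_nhds.sub hgP).sub ((continuous_snd.tendsto _).comp (hP w hw))
  have hres0 : Tendsto (fun n => w - g (p n w).1 - (p n w).2) atTop (𝓝 0) := by
    refine squeeze_zero_norm (fun n => (hinv w hw n).2.2) ?_
    simpa using (tendsto_pow_atTop_nhds_zero_of_lt_one (r := (1 / 2 : ℝ))
      (by norm_num) (by norm_num)).const_mul ‖w‖
  rw [sub_eq_zero.1 (tendsto_nhds_unique hres hres0)]
  exact hPC

theorem corollary4p2 {X Y : Type*}
    [NormedAddCommGroup X] [NormedSpace ℝ X] [CompleteSpace X]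
    [NormedAddCommGroup Y] [NormedSpace ℝ Y] [CompleteSpace Y]
    (F : X → Set Y) (f : X → Y) (f' : X →L[ℝ] Y) (xbar : X) (ybar : Y)
    (hconv : Convex ℝ (setValuedGraph F)) (hclosed : IsClosed (setValuedGraph F))
    (hmem : (xbar, ybar) ∈ setValuedGraph (funAddSetValued f F))
    (hf : HasStrictFDerivAt f f' xbar)
    (hint : ybar ∈ interior
      (setValuedImage (funAddSetValued (fun x => f xbar + f' (x - xbar)) F))) :
    ∃ U ∈ 𝓝 xbar, ∃ V ∈ 𝓝 ybar, ∃ x : Y → X, ∃ γ : ℝ, 0 < γ ∧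
      ContinuousOn x V ∧ Set.MapsTo x V U ∧
      ∀ y ∈ V, y ∈ funAddSetValued f F (x y) ∧ ‖x y - xbar‖ ≤ γ * ‖y - ybar‖ := by
  -- the graph of the linearized mapping, translated so that the reference point is the origin
  set L : X × Y →ₗ[ℝ] X × Y :=
    (LinearMap.fst ℝ X Y).prod (LinearMap.snd ℝ X Y - f'.toLinearMap ∘ₗ LinearMap.fst ℝ X Y)
  set C : Set (X × Y) :=
    {p | (xbar + p.1, ybar - f xbar + (p.2 - f' p.1)) ∈ setValuedGraph F} with hC
  have hCconv : Convex ℝ C :=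
    (hconv.translate_preimage_right (xbar, ybar - f xbar)).linear_preimage L
  have hCclosed : IsClosed C := hclosed.preimage (by fun_prop)
  have hC0 : (0 : X × Y) ∈ C := by
    obtain ⟨z, hz, hyz⟩ := hmem
    have : ybar - f xbar = z := by rw [sub_eq_iff_eq_add']; exact hyz
    simpa [hC, this, setValuedGraph] using hz
  have hCint : (0 : Y) ∈ interior (Prod.snd '' C) := by
    rw [mem_interior_iff_mem_nhds] at hint ⊢
    have hc : Tendsto (fun w : Y => ybar + w) (𝓝 0) (𝓝 ybar) := by
      have : Continuous fun w : Y => ybar + w := by fun_prop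
      simpa using this.tendsto 0
    filter_upwards [hc hint] with w hw
    obtain ⟨x, z, hz, hwz⟩ := hw
    refine ⟨(x - xbar, w), ?_, rfl⟩
    have : ybar - f xbar + (w - f' (x - xbar)) = z := by
      have hwz' : ybar + w = f xbar + f' (x - xbar) + z := hwz
      rw [← sub_eq_iff_eq_add'.2 hwz']
      generalize f' (x - xbar) = v
      abel
    change (xbar + (x - xbar), ybar - f xbar + (w - f' (x - xbar))) ∈ setValuedGraph F
    rw [add_sub_cancel, this]
    exact hz
  have hg : HasStrictFDerivAt (fun u => f (xbar + u) - f xbar - f' u) (0 : X →L[ℝ] Y) 0 := by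
    have h1 : HasStrictFDerivAt (fun u : X => xbar + u) (ContinuousLinearMap.id ℝ X) 0 :=
      (hasStrictFDerivAt_id 0).const_add xbar
    have h2 : HasStrictFDerivAt f f' (xbar + 0) := by rwa [add_zero]
    have h3 := ((h2.comp (0 : X) h1).sub_const (f xbar)).sub f'.hasStrictFDerivAt
    rwa [ContinuousLinearMap.comp_id, sub_self] at h3
  obtain ⟨η, hη, γ, hγ, u, hu, hsol⟩ :=
    exists_continuousOn_selection_of_strict_zero hCconv hCclosed hC0 hCint (by simp) hg
  have hball : ∀ y ∈ ball ybar η, y - ybar ∈ ball (0 : Y) η := fun y hy => by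
    simpa [dist_eq_norm] using hy
  refine ⟨ball xbar (γ * η), ball_mem_nhds _ (by positivity), ball ybar η, ball_mem_nhds _ hη,
    fun y => xbar + u (y - ybar), γ, hγ, ?_, fun y hy => ?_, fun y hy => ⟨?_, ?_⟩⟩
  · exact continuousOn_const.add (hu.comp (by fun_prop) hball)
  · rw [mem_ball, dist_eq_norm, add_sub_cancel_left]
    refine (hsol _ (hball y hy)).2.trans_lt ?_
    gcongr
    exact mem_ball_zero_iff.1 (hball y hy)
  -- The terms in `f'` and `f xbar` cancel, leaving `y - f (x y)` as the element of `F (x y)`.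
  · refine ⟨_, (hsol _ (hball y hy)).1, ?_⟩
    dsimp only
    abel
  · rw [add_sub_cancel_left]
    exact (hsol _ (hball y hy)).2
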